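/- Let $g\ge 0$ be an integer and let $B$ be a symmetric complex $g\times g$ matrix with positive-definite imaginary part. Let $A=\mathbb C^g/(\mathbb Z^g+B\mathbb Z^g)$ be the corresponding principally polarized abelian variety (ppav), with polarization the divisor of $$\theta(z)=\sum_{n\in\mathbb Z^g}e^{2\pi i(n,z)+\pi i(Bn,n)},\qquad z\in\mathbb C^g,$$ where $(\cdot,\cdot)$ is the complex bilinear scalar product. Let $K:\mathbb C^g\to\mathbb C^{2^g}$, $K(z)=(\Theta[\varepsilon](z))_{\varepsilon\in(\mathbb Z/2\mathbb Z)^g}$, be the lift of the Kummer map, with $$\Theta[\varepsilon](z)=\sum_{n\in\mathbb Z^g}e^{2\pi i(2n+\varepsilon,z)+\pi i(2n+\varepsilon,\,B(n+\varepsilon/2))}.$$ Suppose that $A$ is indecomposable, i.e. not isomorphic, as a ppav, to a product of two lower-dimensional (positive-dimensional) ppavs, and suppose that $P,U,V\in\mathbb C^g$ and $c\in\mathbb C$ satisfy $$K(P)=c\,K(0)+\partial_U\partial_VK(0).$$ Then every $z\in\mathbb C^g$ with $\theta(z)=0$ satisfies $$\theta_{UU}(z)\,\theta(z-P)\,\theta(z+P)=\theta_U(z)\,\theta_U(z-P)\,\theta(z+P)+\theta_U(z)\,\theta_U(z+P)\,\theta(z-P),$$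 where $\partial_U$ and the subscript $U$ denote the directional derivative in the direction $U$. -/

import Mathlib

open Complex Matrix

noncomputable section

namespace PPAV

variable {g : ℕ}

/-- `B` lies in the Siegel upper half-space: it is symmetric with positive-definite imaginary
part. It then defines the ppav `A = ℂ^g / (ℤ^g + B ℤ^g)`, polarized by the divisor of `theta B`. -/
structure IsPeriodMatrix (B : Matrix (Fin g) (Fin g) ℂ) : Prop where
  symm : B.IsSymm
  posDef : (B.map Complex.im).PosDef

/-- The lattice `ℤ^g + B ℤ^g` in `ℂ^g`. -/
def lattice (B : Matrix (Fin g) (Fin g) ℂ) : Set (Fin g → ℂ) :=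
  {x | ∃ m n : Fin g → ℤ, x = (fun i => (m i : ℂ)) + B *ᵥ (fun i => (n i : ℂ))}

/-- The Hermitian form `H(x, y) = xᵀ (Im B)⁻¹ ȳ` on `ℂ^g` representing the principal
polarization. -/
def polarization (B : Matrix (Fin g) (Fin g) ℂ) (x y : Fin g → ℂ) : ℂ :=
  x ⬝ᵥ (((B.map Complex.im)⁻¹).map Complex.ofReal *ᵥ star y)

/-- The ppav of `B` is a product of two lower-dimensional ppavs: `ℂ^g` splits into two nonzero
complex subspaces, orthogonal for the polarization, along which the lattice splits too. -/
def IsDecomposable (B : Matrix (Fin g) (Fin g) ℂ) : Prop :=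
  ∃ W₁ W₂ : Submodule ℂ (Fin g → ℂ), W₁ ≠ ⊥ ∧ W₂ ≠ ⊥ ∧ IsCompl W₁ W₂ ∧
    (∀ x ∈ W₁, ∀ y ∈ W₂, polarization B x y = 0) ∧
    ∀ l ∈ lattice B, ∃ l₁ ∈ lattice B, ∃ l₂ ∈ lattice B, l₁ ∈ W₁ ∧ l₂ ∈ W₂ ∧ l = l₁ + l₂

/-- The Riemann theta function
`θ(B, z) = ∑_{n ∈ ℤ^g} exp (2πi (n, z) + πi (B n, n))`. -/
def theta (B : Matrix (Fin g) (Fin g) ℂ) (z : Fin g → ℂ) : ℂ :=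
  ∑' n : Fin g → ℤ,
    let v : Fin g → ℂ := fun i => (n i : ℂ)
    cexp (2 * Real.pi * I * (v ⬝ᵥ z) + Real.pi * I * ((B *ᵥ v) ⬝ᵥ v))

/-- The theta function of the second order
`Θ[ε](B, z) = ∑_{n ∈ ℤ^g} exp (2πi (2n + ε, z) + πi (2n + ε, B (n + ε/2)))`,
with `ε ∈ (ℤ/2)^g` represented by a vector of zeros and ones. -/
def thetaTwo (B : Matrix (Fin g) (Fin g) ℂ) (ε : Fin g → ZMod 2) (z : Fin g → ℂ) : ℂ :=
  ∑' n : Fin g → ℤ,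
    let v : Fin g → ℂ := fun i => 2 * (n i : ℂ) + ((ε i).val : ℂ)
    let w : Fin g → ℂ := fun i => (n i : ℂ) + ((ε i).val : ℂ) / 2
    cexp (2 * Real.pi * I * (v ⬝ᵥ z) + Real.pi * I * (v ⬝ᵥ (B *ᵥ w)))

/-- The lift `K = (Θ[ε])_ε : ℂ^g → ℂ^(2^g)` of the Kummer map. -/
def kummer (B : Matrix (Fin g) (Fin g) ℂ) (z : Fin g → ℂ) : (Fin g → ZMod 2) → ℂ :=
  fun ε => thetaTwo B ε z

/-- The (complex) directional derivative `∂_U f` as a function of the point. -/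
def dirDeriv {F : Type*} [NormedAddCommGroup F] [NormedSpace ℂ F]
    (U : Fin g → ℂ) (f : (Fin g → ℂ) → F) : (Fin g → ℂ) → F :=
  fun z => lineDeriv ℂ f z U

end PPAV

end

/-!
The addition formula `θ(x + y) θ(x - y) = ∑_ε Θ[ε](x) Θ[ε](y)` turns a linear relation between
values and derivatives of the Kummer map `K` into a bilinear relation for `θ`: pairing
`K(P) = c K(0) + ∂_U ∂_V K(0)` with `K(z)` gives, for every `z`,

`θ(z + P) θ(z - P) = c θ² + 2 θ θ_UV - 2 θ_U θ_V`    (`PPAV.theta_mul_theta_of_kummer`).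

In the derivative of the right-hand side along `U` the terms `θ_U θ_UV` cancel, so on the theta
divisor the relation and its derivative read

`θ(z + P) θ(z - P) = -2 θ_U θ_V`  and  `∂_U (θ(z + P) θ(z - P)) = -2 θ_UU θ_V`.

The first multiplied by `θ_UU` and the second multiplied by `θ_U` have the same right-hand side,
which is the claim.

The analytic input is that `θ` and `Θ[ε]` are exponential series whose coefficients decay faster
than any exponential in the frequencies, because a positive-definite form dominates a multiple of
the sum of squares (`PPAV.rapidDecay_gaussian`). This class of series is closed under termwise
directional derivatives (`PPAV.RapidDecay.hasLineDerivAt`), so every iterated directional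
derivative in the argument is a genuine one. The addition formula itself is a rearrangement of the
double series by the parity of `n + m` (`PPAV.parityEquiv`).
-/

namespace PPAV

variable {g : ℕ}

/-! ### Rapidly convergent exponential series -/

/-- The series `∑ₙ cₙ exp (2πi (aₙ, z))` with coefficients `cₙ` and frequencies `aₙ ∈ ℂ^g`. -/
noncomputable def expSeries {ι : Type*} (c : ι → ℂ) (a : ι → Fin g → ℂ) (z : Fin g → ℂ) : ℂ :=
  ∑' n, c n * cexp (2 * Real.pi * I * (a n ⬝ᵥ z))

/-- The coefficients `cₙ` decay faster than every exponential in the `ℓ¹`-norm of the frequencies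
`aₙ`. -/
def RapidDecay {ι : Type*} (c : ι → ℂ) (a : ι → Fin g → ℂ) : Prop :=
  ∀ R : ℝ, Summable fun n => ‖c n‖ * Real.exp (R * ∑ i, ‖a n i‖)

lemma norm_dotProduct_le (a z : Fin g → ℂ) : ‖a ⬝ᵥ z‖ ≤ (∑ i, ‖a i‖) * ‖z‖ := by
  rw [dotProduct, Finset.sum_mul]
  refine (norm_sum_le _ _).trans (Finset.sum_le_sum fun i _ => ?_)
  rw [norm_mul]
  exact mul_le_mul_of_nonneg_left (norm_le_pi_norm z i) (norm_nonneg _)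

lemma norm_two_pi_I_mul (w : ℂ) : ‖2 * Real.pi * I * w‖ = 2 * Real.pi * ‖w‖ := by
  simp [abs_of_pos Real.pi_pos]

lemma norm_cexp_dotProduct_le {r : ℝ} (a z : Fin g → ℂ) (hz : ‖z‖ ≤ r) :
    ‖cexp (2 * Real.pi * I * (a ⬝ᵥ z))‖ ≤ Real.exp (2 * Real.pi * r * ∑ i, ‖a i‖) := by
  refine (norm_exp_le_exp_norm _).trans (Real.exp_le_exp.2 ?_)
  rw [norm_two_pi_I_mul, mul_assoc (2 * Real.pi)]
  have h0 : 0 ≤ ∑ i, ‖a i‖ := Finset.sum_nonneg fun i _ => norm_nonneg _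
  refine mul_le_mul_of_nonneg_left ?_ (by positivity)
  rw [mul_comm r]
  exact (norm_dotProduct_le a z).trans (mul_le_mul_of_nonneg_left hz h0)

section

variable {ι : Type*} {c : ι → ℂ} {a : ι → Fin g → ℂ}

lemma RapidDecay.summable_norm (h : RapidDecay c a) (z : Fin g → ℂ) :
    Summable fun n => ‖c n * cexp (2 * Real.pi * I * (a n ⬝ᵥ z))‖ := by
  refine Summable.of_nonneg_of_le (fun n => norm_nonneg _) (fun n => ?_) (h (2 * Real.pi * ‖z‖))
  rw [norm_mul]
  exact mul_le_mul_of_nonneg_left (norm_cexp_dotProduct_le _ _ le_rfl) (norm_nonneg _)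

lemma RapidDecay.mul_dotProduct (h : RapidDecay c a) (U : Fin g → ℂ) :
    RapidDecay (fun n => c n * (2 * Real.pi * I * (a n ⬝ᵥ U))) a := by
  intro R
  refine Summable.of_nonneg_of_le (fun n => by positivity) (fun n => ?_)
    ((h (R + 1)).mul_left (2 * Real.pi * ‖U‖))
  set S := ∑ i, ‖a n i‖ with hS
  -- the linear factor is absorbed by `S ≤ exp S`
  have h2 : S ≤ Real.exp S := by linarith [Real.add_one_le_exp S]
  have h3 : ‖a n ⬝ᵥ U‖ ≤ Real.exp S * ‖U‖ :=
    (norm_dotProduct_le _ _).trans (mul_le_mul_of_nonneg_right h2 (norm_nonneg _))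
  rw [norm_mul, norm_two_pi_I_mul, add_mul, one_mul, Real.exp_add]
  calc ‖c n‖ * (2 * Real.pi * ‖a n ⬝ᵥ U‖) * Real.exp (R * S)
      ≤ ‖c n‖ * (2 * Real.pi * (Real.exp S * ‖U‖)) * Real.exp (R * S) := by gcongr
    _ = _ := by ring

/-- A rapidly convergent exponential series is differentiated term by term. -/
lemma RapidDecay.hasLineDerivAt (h : RapidDecay c a) (U z : Fin g → ℂ) :
    HasLineDerivAt ℂ (expSeries c a)
      (expSeries (fun n => c n * (2 * Real.pi * I * (a n ⬝ᵥ U))) a z) z U := by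
  set c' : ι → ℂ := fun n => c n * (2 * Real.pi * I * (a n ⬝ᵥ U)) with hc'
  have key := hasDerivAt_tsum_of_isPreconnected (𝕜 := ℂ)
    (g := fun n t => c n * cexp (2 * Real.pi * I * (a n ⬝ᵥ (z + t • U))))
    (g' := fun n t => c' n * cexp (2 * Real.pi * I * (a n ⬝ᵥ (z + t • U))))
    (y₀ := 0) (y := 0) (h.mul_dotProduct U (2 * Real.pi * (‖z‖ + ‖U‖)))
    Metric.isOpen_ball (convex_ball (0 : ℂ) 1).isPreconnected ?_ ?_
    (Metric.mem_ball_self one_pos) (h.summable_norm _).of_norm (Metric.mem_ball_self one_pos)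
  · simpa [HasLineDerivAt, expSeries] using key
  · intro n t _
    have h1 : HasDerivAt (fun t : ℂ => 2 * Real.pi * I * (a n ⬝ᵥ (z + t • U)))
        (2 * Real.pi * I * (a n ⬝ᵥ U)) t := by
      simp only [dotProduct_add, dotProduct_smul, smul_eq_mul]
      simpa using (((hasDerivAt_id t).mul_const (a n ⬝ᵥ U)).const_add
        (a n ⬝ᵥ z)).const_mul (2 * Real.pi * I)
    refine (h1.cexp.const_mul (c n)).congr_deriv ?_
    simp only [hc']
    ring
  · intro n t ht
    have ht' : ‖t‖ ≤ 1 := (mem_ball_zero_iff.1 ht).le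
    rw [norm_mul]
    refine mul_le_mul_of_nonneg_left (norm_cexp_dotProduct_le _ _ ?_) (norm_nonneg _)
    refine (norm_add_le _ _).trans ?_
    rw [norm_smul]
    gcongr
    exact mul_le_of_le_one_left (norm_nonneg _) ht'

end

/-- `f` is the sum of a rapidly convergent exponential series indexed by `ℤ^g`. -/
def IsExpSeries (f : (Fin g → ℂ) → ℂ) : Prop :=
  ∃ (c : (Fin g → ℤ) → ℂ) (a : (Fin g → ℤ) → Fin g → ℂ), RapidDecay c a ∧ f = expSeries c a

lemma IsExpSeries.hasLineDerivAt {f : (Fin g → ℂ) → ℂ} (hf : IsExpSeries f) (U z : Fin g → ℂ) :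
    HasLineDerivAt ℂ f (dirDeriv U f z) z U := by
  obtain ⟨c, a, h, rfl⟩ := hf
  exact (h.hasLineDerivAt U z).lineDifferentiableAt.hasLineDerivAt

lemma IsExpSeries.dirDeriv {f : (Fin g → ℂ) → ℂ} (hf : IsExpSeries f) (U : Fin g → ℂ) :
    IsExpSeries (dirDeriv U f) := by
  obtain ⟨c, a, h, rfl⟩ := hf
  exact ⟨_, a, h.mul_dotProduct U, funext fun z => (h.hasLineDerivAt U z).lineDeriv⟩

/-! ### Convergence of the theta series -/

/-- A positive-definite real quadratic form is bounded below by a positive multiple of the sum of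
squares. -/
lemma exists_pos_mul_sum_sq_le {Y : Matrix (Fin g) (Fin g) ℝ} (hY : Y.PosDef) :
    ∃ δ : ℝ, 0 < δ ∧ ∀ x : Fin g → ℝ, δ * ∑ i, x i ^ 2 ≤ x ⬝ᵥ (Y *ᵥ x) := by
  have hcpt : IsCompact {x : Fin g → ℝ | ∑ i, x i ^ 2 = 1} := by
    refine Metric.isCompact_of_isClosed_isBounded
      (isClosed_eq (by fun_prop) continuous_const) ?_
    refine (Metric.isBounded_closedBall (x := (0 : Fin g → ℝ)) (r := 1)).subset fun x hx => ?_
    rw [mem_closedBall_zero_iff, pi_norm_le_iff_of_nonneg zero_le_one]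
    intro i
    rw [Real.norm_eq_abs, ← sq_le_one_iff_abs_le_one]
    have hx' : ∑ i, x i ^ 2 = 1 := hx
    rw [← hx']
    exact Finset.single_le_sum (f := fun i => x i ^ 2) (fun j _ => sq_nonneg _)
      (Finset.mem_univ i)
  have hcont : Continuous fun x : Fin g → ℝ => x ⬝ᵥ (Y *ᵥ x) := by
    simp only [dotProduct, mulVec]
    fun_prop
  obtain ⟨δ, hδ, hmin⟩ := hcpt.exists_forall_le' hcont.continuousOn (a := 0) fun x hx => by
    have hx0 : x ≠ 0 := by
      rintro rfl
      simp at hx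
    simpa using hY.dotProduct_mulVec_pos hx0
  refine ⟨δ, hδ, fun x => ?_⟩
  set N := ∑ i, x i ^ 2 with hN
  have hN0 : 0 ≤ N := Finset.sum_nonneg fun i _ => sq_nonneg _
  rcases hN0.eq_or_lt with h0 | hpos
  · rw [← h0, mul_zero]
    simpa using hY.posSemidef.dotProduct_mulVec_nonneg x
  -- otherwise rescale to the unit sphere
  have hr : (Real.sqrt N)⁻¹ ^ 2 = N⁻¹ := by rw [inv_pow, Real.sq_sqrt hN0]
  have h1 := hmin ((Real.sqrt N)⁻¹ • x) (by
    simp only [Set.mem_ofPred_eq, Pi.smul_apply, smul_eq_mul, mul_pow, hr]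
    rw [← Finset.mul_sum, ← hN, inv_mul_cancel₀ hpos.ne'])
  rw [mulVec_smul, smul_dotProduct, dotProduct_smul, smul_eq_mul, smul_eq_mul, ← mul_assoc,
    ← sq, hr] at h1
  rwa [inv_mul_eq_div, le_div_iff₀ hpos] at h1

/-- Sums over `ℤ^g` of products of nonnegative summable functions of one coordinate converge. -/
lemma summable_prod_apply {f : ℤ → ℝ} (hf0 : ∀ n, 0 ≤ f n) (hf : Summable f) (g : ℕ) :
    Summable fun n : Fin g → ℤ => ∏ i, f (n i) := by
  induction g with
  | zero => exact (hasSum_fintype _).summable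
  | succ g ih =>
    rw [← (Fin.consEquiv fun _ : Fin (g + 1) => ℤ).summable_iff]
    have := hf.mul_of_nonneg ih hf0 fun n => Finset.prod_nonneg fun i _ => hf0 _
    refine this.congr fun x => ?_
    simp [Fin.consEquiv, Fin.prod_univ_succ]

lemma summable_gaussian {Y : Matrix (Fin g) (Fin g) ℝ} (hY : Y.PosDef) {s : ℝ} (hs : 0 < s)
    (R : ℝ) :
    Summable fun n : Fin g → ℤ =>
      Real.exp (-s * ((fun i => (n i : ℝ)) ⬝ᵥ (Y *ᵥ fun i => (n i : ℝ)))) *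
        Real.exp (R * ∑ i, |(n i : ℝ)|) := by
  obtain ⟨δ, hδ, hle⟩ := exists_pos_mul_sum_sq_le hY
  have h1 : Summable fun n : ℤ => Real.exp (-(s * δ) * (n : ℝ) ^ 2 + R * |(n : ℝ)|) := by
    have := summable_pow_mul_jacobiTheta₂_term_bound (R / (2 * Real.pi))
      (T := s * δ / Real.pi) (by positivity) 0
    refine this.congr fun n => ?_
    rw [pow_zero, one_mul]
    congr 1
    push_cast
    field_simp
    ring
  refine Summable.of_nonneg_of_le (fun n => by positivity) (fun n => ?_)
    (summable_prod_apply (fun _ => (Real.exp_pos _).le) h1 g)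
  rw [← Real.exp_add, ← Real.exp_sum, Real.exp_le_exp, Finset.sum_add_distrib, ← Finset.mul_sum,
    ← Finset.mul_sum]
  have := mul_le_mul_of_nonneg_left (hle fun i => (n i : ℝ)) hs.le
  linarith

/-- On real vectors the imaginary part of the quadratic form of `B` is the quadratic form of
`Im B`. -/
lemma im_mulVec_dotProduct_self (B : Matrix (Fin g) (Fin g) ℂ) (x : Fin g → ℝ) :
    ((B *ᵥ fun i => (x i : ℂ)) ⬝ᵥ fun i => (x i : ℂ)).im = x ⬝ᵥ (B.map Complex.im *ᵥ x) := by
  simp only [dotProduct, mulVec, Complex.im_sum, Matrix.map_apply]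
  refine Finset.sum_congr rfl fun i _ => ?_
  rw [Complex.im_mul_ofReal, Complex.im_sum, mul_comm]
  simp only [Complex.im_mul_ofReal]

/-- Gaussian coefficients decay rapidly, over any family of distinct integral frequencies. -/
lemma rapidDecay_gaussian {B : Matrix (Fin g) (Fin g) ℂ} (hB : IsPeriodMatrix B) {s : ℝ}
    (hs : 0 < s) {ι : Type*} {f : ι → Fin g → ℤ} (hf : Function.Injective f) :
    RapidDecay
      (fun n => cexp (s * I * ((B *ᵥ fun i => (f n i : ℂ)) ⬝ᵥ fun i => (f n i : ℂ))))
      (fun n i => (f n i : ℂ)) := by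
  intro R
  refine ((summable_gaussian hB.posDef hs R).comp_injective hf).congr fun n => ?_
  have h := im_mulVec_dotProduct_self B fun i => (f n i : ℝ)
  simp only [Complex.ofReal_intCast] at h
  simp only [Function.comp_apply, ← h, Complex.norm_exp, Complex.norm_intCast]
  congr 2
  simp [mul_assoc]

/-- The integral vector `2n + ε` attached to `n ∈ ℤ^g` and a characteristic `ε`. -/
def charShift (ε : Fin g → ZMod 2) (n : Fin g → ℤ) : Fin g → ℤ :=
  fun i => 2 * n i + ((ε i).val : ℤ)

lemma charShift_injective (ε : Fin g → ZMod 2) : Function.Injective (charShift ε) := by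
  intro m n h
  funext i
  have := congrFun h i
  simp only [charShift] at this
  omega

lemma theta_eq_expSeries (B : Matrix (Fin g) (Fin g) ℂ) :
    theta B = expSeries
      (fun n : Fin g → ℤ =>
        cexp ((Real.pi : ℝ) * I * ((B *ᵥ fun i => (n i : ℂ)) ⬝ᵥ fun i => (n i : ℂ))))
      (fun n i => (n i : ℂ)) := by
  funext z
  refine tsum_congr fun n => ?_
  rw [← Complex.exp_add, add_comm]

lemma thetaTwo_eq_expSeries (B : Matrix (Fin g) (Fin g) ℂ) (ε : Fin g → ZMod 2) :
    thetaTwo B ε = expSeries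
      (fun n : Fin g → ℤ => cexp ((Real.pi / 2 : ℝ) * I *
        ((B *ᵥ fun i => (charShift ε n i : ℂ)) ⬝ᵥ fun i => (charShift ε n i : ℂ))))
      (fun n i => (charShift ε n i : ℂ)) := by
  funext z
  refine tsum_congr fun n => ?_
  rw [← Complex.exp_add, add_comm]
  have hv : (fun i => 2 * (n i : ℂ) + ((ε i).val : ℂ)) = fun i => (charShift ε n i : ℂ) := by
    funext i
    simp [charShift]
  have hw : (fun i => (n i : ℂ) + ((ε i).val : ℂ) / 2) =
      (1 / 2 : ℂ) • fun i => (charShift ε n i : ℂ) := by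
    funext i
    simp only [charShift, Pi.smul_apply, smul_eq_mul]
    push_cast
    ring
  simp only [hv, hw, mulVec_smul, dotProduct_smul, smul_eq_mul]
  rw [dotProduct_comm (fun i => (charShift ε n i : ℂ)) (B *ᵥ _)]
  congr 2
  push_cast
  ring

lemma IsPeriodMatrix.isExpSeries_theta {B : Matrix (Fin g) (Fin g) ℂ} (hB : IsPeriodMatrix B) :
    IsExpSeries (theta B) :=
  ⟨_, _, rapidDecay_gaussian hB Real.pi_pos Function.injective_id, theta_eq_expSeries B⟩

lemma IsPeriodMatrix.isExpSeries_thetaTwo {B : Matrix (Fin g) (Fin g) ℂ} (hB : IsPeriodMatrix B)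
    (ε : Fin g → ZMod 2) : IsExpSeries (thetaTwo B ε) :=
  ⟨_, _, rapidDecay_gaussian hB (half_pos Real.pi_pos) (charShift_injective ε),
    thetaTwo_eq_expSeries B ε⟩

/-! ### The addition formula -/

/-- Pairs `(n, m)` of integral vectors written as `(a + b + ε, a - b)`, where `ε` is the class of
`n + m` modulo `2`; then `n + m = 2a + ε` and `n - m = 2b + ε`. -/
def parityEquiv (g : ℕ) :
    (Fin g → ZMod 2) × ((Fin g → ℤ) × (Fin g → ℤ)) ≃ (Fin g → ℤ) × (Fin g → ℤ) where
  toFun p := (fun i => p.2.1 i + p.2.2 i + ((p.1 i).val : ℤ), fun i => p.2.1 i - p.2.2 i)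
  invFun q := (fun i => ((q.1 i + q.2 i : ℤ) : ZMod 2),
    fun i => (q.1 i + q.2 i) / 2, fun i => (q.1 i - q.2 i) / 2)
  left_inv := by
    rintro ⟨ε, a, b⟩
    have hlt : ∀ i, (ε i).val < 2 := fun i => ZMod.val_lt _
    refine Prod.ext (funext fun i => ?_) (Prod.ext (funext fun i => ?_) (funext fun i => ?_))
    · have : a i + b i + ((ε i).val : ℤ) + (a i - b i) = 2 * a i + ((ε i).val : ℤ) := by ring
      simp only [this]
      push_cast
      rw [show (2 : ZMod 2) = 0 from rfl, zero_mul, zero_add, ZMod.natCast_zmod_val]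
    · have := hlt i
      simp only
      omega
    · have := hlt i
      simp only
      omega
  right_inv := by
    rintro ⟨n, m⟩
    have hval : ∀ k : ℤ, (((k : ZMod 2)).val : ℤ) = k % 2 := fun k => ZMod.val_intCast k
    refine Prod.ext (funext fun i => ?_) (funext fun i => ?_)
    · simp only [hval]
      omega
    · simp only
      omega

/-- **Addition formula**: `θ(x + y) θ(x - y) = ∑_ε Θ[ε](x) Θ[ε](y)`. -/
theorem theta_add_mul_theta_sub {B : Matrix (Fin g) (Fin g) ℂ} (hB : IsPeriodMatrix B)
    (x y : Fin g → ℂ) :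
    theta B (x + y) * theta B (x - y) = ∑ ε, thetaTwo B ε x * thetaTwo B ε y := by
  have hθ := rapidDecay_gaussian hB Real.pi_pos (f := fun n : Fin g → ℤ => n)
    Function.injective_id
  have hΘ := fun ε => rapidDecay_gaussian hB (half_pos Real.pi_pos) (charShift_injective ε)
  have hsum := summable_mul_of_summable_norm (hθ.summable_norm (x + y)) (hθ.summable_norm (x - y))
  have hsum' := (parityEquiv g).summable_iff.2 hsum
  simp only [Function.comp_def] at hsum'
  simp only [theta_eq_expSeries, thetaTwo_eq_expSeries, expSeries]
  rw [tsum_mul_tsum_of_summable_norm (hθ.summable_norm (x + y)) (hθ.summable_norm (x - y)),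
    ← (parityEquiv g).tsum_eq, hsum'.tsum_prod, tsum_fintype]
  refine Finset.sum_congr rfl fun ε _ => ?_
  rw [tsum_mul_tsum_of_summable_norm ((hΘ ε).summable_norm x) ((hΘ ε).summable_norm y)]
  refine tsum_congr fun p => ?_
  obtain ⟨a, b⟩ := p
  simp only [← Complex.exp_add]
  -- with `v = 2a + ε` and `w = 2b + ε` the two frequencies on the left are `(v ± w) / 2`
  set v : Fin g → ℂ := fun i => (charShift ε a i : ℂ) with hv
  set w : Fin g → ℂ := fun i => (charShift ε b i : ℂ) with hw
  have h1 : (fun i => (((parityEquiv g (ε, a, b)).1 i : ℤ) : ℂ)) = (1 / 2 : ℂ) • (v + w) := by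
    funext i
    simp only [hv, hw, charShift, parityEquiv, Equiv.coe_fn_mk, Pi.smul_apply, Pi.add_apply,
      smul_eq_mul]
    push_cast
    ring
  have h2 : (fun i => (((parityEquiv g (ε, a, b)).2 i : ℤ) : ℂ)) = (1 / 2 : ℂ) • (v - w) := by
    funext i
    simp only [hv, hw, charShift, parityEquiv, Equiv.coe_fn_mk, Pi.smul_apply, Pi.sub_apply,
      smul_eq_mul]
    push_cast
    ring
  rw [h1, h2]
  congr 1
  simp only [mulVec_smul, mulVec_add, mulVec_sub, dotProduct_smul, smul_dotProduct,
    dotProduct_add, dotProduct_sub, add_dotProduct, sub_dotProduct, smul_eq_mul]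
  push_cast
  ring

/-! ### The Kummer relation as a bilinear equation -/

/-- The Kummer relation paired with `K(z)`, an identity for the theta function alone. -/
theorem theta_mul_theta_of_kummer {B : Matrix (Fin g) (Fin g) ℂ} (hB : IsPeriodMatrix B)
    {P U V : Fin g → ℂ} {c : ℂ}
    (hK : kummer B P = c • kummer B 0 + dirDeriv U (dirDeriv V (kummer B)) 0) (z : Fin g → ℂ) :
    theta B (z + P) * theta B (z - P) = c * theta B z ^ 2 +
      2 * (theta B z * dirDeriv U (dirDeriv V (theta B)) z) -
      2 * (dirDeriv U (theta B) z * dirDeriv V (theta B) z) := by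
  have hθ := hB.isExpSeries_theta
  have hΘ := hB.isExpSeries_thetaTwo
  -- derivatives of `y ↦ f (z ± y)` along a line, for an entire exponential series `f`
  have hadd : ∀ {f : (Fin g → ℂ) → ℂ}, IsExpSeries f → ∀ y W : Fin g → ℂ,
      HasDerivAt (fun t : ℂ => f (z + (y + t • W))) (dirDeriv W f (z + y)) 0 := by
    intro f hf y W
    have h := hf.hasLineDerivAt W (z + y)
    simpa only [HasLineDerivAt, add_assoc] using h
  have hsub : ∀ {f : (Fin g → ℂ) → ℂ}, IsExpSeries f → ∀ y W : Fin g → ℂ,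
      HasDerivAt (fun t : ℂ => f (z - (y + t • W))) (-dirDeriv W f (z - y)) 0 := by
    intro f hf y W
    have h : HasDerivAt (fun t : ℂ => f (z - y + t • W)) (dirDeriv W f (z - y)) (-0) := by
      rw [neg_zero]
      exact hf.hasLineDerivAt W (z - y)
    have h' := h.comp (0 : ℂ) (hasDerivAt_neg (0 : ℂ))
    simp only [Function.comp_def, neg_smul, mul_neg, mul_one] at h'
    simpa only [sub_add_eq_sub_sub, ← sub_eq_add_neg] using h'
  -- the derivatives of `K` are computed coordinatewise
  have hK1 : ∀ y, dirDeriv V (kummer B) y = fun ε => dirDeriv V (thetaTwo B ε) y := fun y =>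
    HasLineDerivAt.lineDeriv (hasDerivAt_pi.2 fun ε => (hΘ ε).hasLineDerivAt V y)
  have hK2 : dirDeriv U (dirDeriv V (kummer B)) 0 =
      fun ε => dirDeriv U (dirDeriv V (thetaTwo B ε)) 0 := by
    rw [show dirDeriv V (kummer B) = _ from funext hK1]
    exact HasLineDerivAt.lineDeriv
      (hasDerivAt_pi.2 fun ε => ((hΘ ε).dirDeriv V).hasLineDerivAt U 0)
  -- the addition formula differentiated in its second argument
  have hV : ∀ y, ∑ ε, thetaTwo B ε z * dirDeriv V (thetaTwo B ε) y =
      dirDeriv V (theta B) (z + y) * theta B (z - y) -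
        theta B (z + y) * dirDeriv V (theta B) (z - y) := by
    intro y
    have hl := HasDerivAt.fun_sum (u := Finset.univ) fun ε _ =>
      ((hΘ ε).hasLineDerivAt V y).const_mul (thetaTwo B ε z)
    have hr := (hadd hθ y V).mul (hsub hθ y V)
    simp only [← theta_add_mul_theta_sub hB] at hl
    rw [hl.unique hr]
    simp only [zero_smul, add_zero]
    ring
  have hUV : ∑ ε, thetaTwo B ε z * dirDeriv U (dirDeriv V (thetaTwo B ε)) 0 =
      2 * (theta B z * dirDeriv U (dirDeriv V (theta B)) z) -
      2 * (dirDeriv U (theta B) z * dirDeriv V (theta B) z) := by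
    have hl := HasDerivAt.fun_sum (u := Finset.univ) fun ε _ =>
      (((hΘ ε).dirDeriv V).hasLineDerivAt U 0).const_mul (thetaTwo B ε z)
    have hr := ((hadd (hθ.dirDeriv V) 0 U).mul (hsub hθ 0 U)).sub
      ((hadd hθ 0 U).mul (hsub (hθ.dirDeriv V) 0 U))
    simp only [hV] at hl
    rw [hl.unique hr]
    simp only [zero_smul, add_zero, sub_zero]
    ring
  have h0 := theta_add_mul_theta_sub hB z 0
  rw [add_zero, sub_zero] at h0
  rw [theta_add_mul_theta_sub hB z P, add_sub_assoc, ← hUV, sq, h0, Finset.mul_sum,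
    ← Finset.sum_add_distrib]
  refine Finset.sum_congr rfl fun ε _ => ?_
  have h := congrFun hK ε
  rw [hK2] at h
  simp only [kummer, Pi.add_apply, Pi.smul_apply, smul_eq_mul] at h
  rw [h]
  ring

end PPAV

theorem mainTheorem2 (g : ℕ) (B : Matrix (Fin g) (Fin g) ℂ)
    (hB : PPAV.IsPeriodMatrix B) (hInd : ¬ PPAV.IsDecomposable B)
    (P U V : Fin g → ℂ) (c : ℂ)
    (hK : PPAV.kummer B P =
      c • PPAV.kummer B 0 + PPAV.dirDeriv U (PPAV.dirDeriv V (PPAV.kummer B)) 0)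
    (z : Fin g → ℂ) (hz : PPAV.theta B z = 0) :
    PPAV.dirDeriv U (PPAV.dirDeriv U (PPAV.theta B)) z *
        PPAV.theta B (z - P) * PPAV.theta B (z + P) =
      PPAV.dirDeriv U (PPAV.theta B) z *
          PPAV.dirDeriv U (PPAV.theta B) (z - P) * PPAV.theta B (z + P) +
        PPAV.dirDeriv U (PPAV.theta B) z *
          PPAV.dirDeriv U (PPAV.theta B) (z + P) * PPAV.theta B (z - P) := by
  have hθ := hB.isExpSeries_theta
  have hrel := PPAV.theta_mul_theta_of_kummer hB hK
  have hplus : HasDerivAt (fun t : ℂ => PPAV.theta B (z + t • U + P))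
      (PPAV.dirDeriv U (PPAV.theta B) (z + P)) 0 := by
    have h := hθ.hasLineDerivAt U (z + P)
    simpa only [HasLineDerivAt, add_right_comm] using h
  have hminus : HasDerivAt (fun t : ℂ => PPAV.theta B (z + t • U - P))
      (PPAV.dirDeriv U (PPAV.theta B) (z - P)) 0 := by
    have h := hθ.hasLineDerivAt U (z - P)
    simpa only [HasLineDerivAt, sub_add_eq_add_sub] using h
  -- differentiate the bilinear relation along `U`
  have hl := hplus.mul hminus
  have hr := ((((hθ.hasLineDerivAt U z).pow 2).const_mul c).add
    (((hθ.hasLineDerivAt U z).mul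
      (((hθ.dirDeriv V).dirDeriv U).hasLineDerivAt U z)).const_mul 2)).sub
    ((((hθ.dirDeriv U).hasLineDerivAt U z).mul
      ((hθ.dirDeriv V).hasLineDerivAt U z)).const_mul 2)
  have heq := hl.unique (hr.congr_of_eventuallyEq
    (Filter.Eventually.of_forall fun t => hrel (z + t • U)))
  have hrel0 := hrel z
  simp only [zero_smul, add_zero, hz] at heq hrel0
  linear_combination PPAV.dirDeriv U (PPAV.dirDeriv U (PPAV.theta B)) z * hrel0 -
    PPAV.dirDeriv U (PPAV.theta B) z * heq
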